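/- Let $M$ be a connected smooth manifold (Hausdorff, without boundary) of finite dimension $\dim M\geq 2$, and let $(x_i,y_i)\in M\times M$, $i=1,\dots,n$, be concordant pairs of points, i.e. $x_i\neq x_j$ and $y_i\neq y_j$ for all $i\neq j$. Then there is a smooth diffeomorphism $\Phi\colon M\to M$ with $\Phi(x_i)=y_i$ for all $i=1,\dots,n$. -/

import Mathlib

open scoped Manifold ContDiff

/-- Pairs `p i = (x i, y i)` of points of `M` are concordant if `x i ≠ x j` and `y i ≠ y j`
whenever `i ≠ j`. -/
def Concordant {M : Type*} {n : ℕ} (p : Fin n → M × M) : Prop :=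
  ∀ i j : Fin n, i ≠ j → (p i).1 ≠ (p j).1 ∧ (p i).2 ≠ (p j).2

/-!
The diffeomorphism is built one point at a time: once the first points have reached their targets,
the image of the next point is moved to its target by a diffeomorphism that fixes the targets
already reached. This works because the diffeomorphisms supported in a connected open set `U` act
transitively on `U` (`exists_diffeomorph_of_isPreconnected`), and because in dimension at least two
the complement of a finite set is connected (`isPreconnected_compl_finset`).

Transitivity is local: each point of `U` can be moved to every nearby point
(`eventually_exists_diffeomorph_of_isOpen`), so orbits are open in `U`, and connectedness leaves
only one. The local statement takes place in a chart. No flows are needed: with `ρ` a bump function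
equal to `1` at `c`, the map `z ↦ z + ρ z • (q - c)` sends `c` to `q`, is the identity off a ball,
and is a contractive perturbation of the identity when `q` is close to `c`, hence a diffeomorphism.
It extends by the identity to `M`, smoothly because `M` is Hausdorff.
-/

open Set Filter Topology Metric

/-! ### Compactly supported diffeomorphisms of the model space -/

/-- A small smooth Lipschitz perturbation of the identity is a smooth diffeomorphism: it is a
homeomorphism by the contraction principle, and its derivative is invertible by the Neumann
series. -/
lemma exists_diffeomorph_id_add {E : Type*} [NormedAddCommGroup E] [NormedSpace ℝ E]
    [CompleteSpace E] {g : E → E} {K : NNReal} (hK : K < 1) (hg : LipschitzWith K g)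
    (hs : ContDiff ℝ ∞ g) :
    ∃ f : E ≃ₘ^∞⟮𝓘(ℝ, E), 𝓘(ℝ, E)⟯ E, ∀ z, f z = z + g z := by
  have hf : ApproximatesLinearOn (fun z => z + g z)
      ((ContinuousLinearEquiv.refl ℝ E : E ≃L[ℝ] E) : E →L[ℝ] E) univ K := by
    rw [ApproximatesLinearOn.approximatesLinearOn_iff_lipschitzOnWith, lipschitzOnWith_univ]
    convert hg using 1
    ext z
    simp
  have hc : Subsingleton E ∨
      K < ‖((ContinuousLinearEquiv.refl ℝ E : E ≃L[ℝ] E).symm : E →L[ℝ] E)‖₊⁻¹ := by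
    rcases subsingleton_or_nontrivial E with h | h
    · exact Or.inl h
    · right
      have : ‖((ContinuousLinearEquiv.refl ℝ E : E ≃L[ℝ] E).symm : E →L[ℝ] E)‖₊ = 1 := by
        rw [← NNReal.coe_inj]
        exact ContinuousLinearMap.norm_id
      rwa [this, inv_one]
  let h : E ≃ₜ E := hf.toHomeomorph _ hc
  have hsm : ContDiff ℝ ∞ h := contDiff_id.add hs
  have hsymm : ContDiff ℝ ∞ h.symm := by
    rw [contDiff_iff_contDiffAt]
    intro a
    set t : E →L[ℝ] E := fderiv ℝ g (h.symm a)
    have ht : ‖-t‖ < 1 := by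
      rw [norm_neg]
      exact (norm_fderiv_le_of_lipschitz ℝ hg).trans_lt (by exact_mod_cast hK)
    refine h.toOpenPartialHomeomorph.contDiffAt_symm
      (f₀' := ContinuousLinearEquiv.unitsEquiv ℝ E (Units.oneSub (-t) ht)) (mem_univ a) ?_
      hsm.contDiffAt
    have hd : HasFDerivAt (fun z => z + g z) (ContinuousLinearMap.id ℝ E + t) (h.symm a) :=
      (hasFDerivAt_id _).add ((hs.differentiable (by simp)) _).hasFDerivAt
    convert! hd using 1
    ext z
    simp [ContinuousLinearEquiv.unitsEquiv_apply, Units.val_oneSub]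
  exact ⟨⟨h.toEquiv, hsm.contMDiff, hsymm.contMDiff⟩, fun z => rfl⟩

/-- The centre of a ball can be pushed to any nearby point by a diffeomorphism supported in the
ball. -/
lemma eventually_exists_diffeomorph_closedBall {E : Type*} [NormedAddCommGroup E]
    [InnerProductSpace ℝ E] [FiniteDimensional ℝ E] (c : E) {r : ℝ} (hr : 0 < r) :
    ∀ᶠ q in 𝓝 c, ∃ f : E ≃ₘ^∞⟮𝓘(ℝ, E), 𝓘(ℝ, E)⟯ E,
      f c = q ∧ ∀ z ∉ closedBall c r, f z = z := by
  let ρ : ContDiffBump c := ⟨r / 2, r, half_pos hr, half_lt_self hr⟩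
  obtain ⟨C, hC⟩ := (ρ.contDiff (n := 1)).lipschitzWith_of_hasCompactSupport (𝕂 := ℝ)
    ρ.hasCompactSupport one_ne_zero
  have hsmall : ∀ᶠ q in 𝓝 c, C * ‖q - c‖₊ < 1 := by
    have : Tendsto (fun q : E => C * ‖q - c‖₊) (𝓝 c) (𝓝 (C * ‖c - c‖₊)) :=
      Continuous.tendsto (by fun_prop) c
    refine this.eventually_lt_const ?_
    simp
  filter_upwards [hsmall] with q hq
  have hlip : LipschitzWith (C * ‖q - c‖₊) fun z => ρ z • (q - c) := by
    refine LipschitzWith.of_dist_le_mul fun z w => ?_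
    rw [dist_eq_norm, ← sub_smul, norm_smul]
    have := hC.dist_le_mul z w
    rw [dist_eq_norm] at this
    push_cast
    nlinarith [norm_nonneg (q - c)]
  obtain ⟨f, hf⟩ := exists_diffeomorph_id_add hq hlip (ρ.contDiff.smul contDiff_const)
  refine ⟨f, ?_, fun z hz => ?_⟩
  · rw [hf, ρ.one_of_mem_closedBall (mem_closedBall_self (half_pos hr).le)]
    simp
  · rw [hf, ρ.zero_of_le_dist (not_le.1 hz).le]
    simp

/-! ### Extending diffeomorphisms from a chart by the identity -/

section ExtendByIdentity

variable {M E : Type*} [TopologicalSpace M] [TopologicalSpace E]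

open Classical in
/-- The self-map of `M` that is `f` read in the chart `e` on the domain of `e`, and the identity
elsewhere. -/
noncomputable def extendByIdentity (e : OpenPartialHomeomorph M E) (f : E → E) (m : M) : M :=
  if m ∈ e.source then e.symm (f (e m)) else m

lemma extendByIdentity_of_mem {e : OpenPartialHomeomorph M E} {f : E → E} {m : M}
    (hm : m ∈ e.source) : extendByIdentity e f m = e.symm (f (e m)) := if_pos hm

/-- If `f` is supported in `K`, then its extension is supported in the preimage of `K`. -/
lemma extendByIdentity_of_notMem {e : OpenPartialHomeomorph M E} {f : E → E} {K : Set E}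
    (hf : ∀ z ∉ K, f z = z) {m : M} (hm : m ∉ e.symm '' K) : extendByIdentity e f m = m := by
  by_cases hs : m ∈ e.source
  · rw [extendByIdentity_of_mem hs, hf, e.left_inv hs]
    exact fun h => hm ⟨_, h, e.left_inv hs⟩
  · exact if_neg hs

lemma leftInverse_extendByIdentity {e : OpenPartialHomeomorph M E} {f g : E → E}
    (hgf : Function.LeftInverse g f) (hf : MapsTo f e.target e.target) :
    Function.LeftInverse (extendByIdentity e g) (extendByIdentity e f) := by
  intro m
  by_cases hs : m ∈ e.source
  · have hm := hf (e.map_source hs)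
    rw [extendByIdentity_of_mem hs, extendByIdentity_of_mem (e.map_target hm), e.right_inv hm,
      hgf, e.left_inv hs]
  · have : ∀ h : E → E, extendByIdentity e h m = m := fun h => if_neg hs
    rw [this, this]

end ExtendByIdentity

section Manifold

variable {E : Type*} [NormedAddCommGroup E] [InnerProductSpace ℝ E]
  {M : Type*} [TopologicalSpace M] [ChartedSpace E M]

/-- Hausdorffness is what makes the extension smooth: the image of the compact support is closed
in `M`, so the extension is the identity near every point outside the domain of the chart. -/
lemma contMDiff_extendByIdentity [T2Space M] [IsManifold 𝓘(ℝ, E) ∞ M] (p : M) {f : E → E}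
    (hf : ContDiff ℝ ∞ f) {K : Set E} (hK : IsCompact K) (hKt : K ⊆ (chartAt E p).target)
    (hid : ∀ z ∉ K, f z = z) (hmaps : MapsTo f (chartAt E p).target (chartAt E p).target) :
    ContMDiff 𝓘(ℝ, E) 𝓘(ℝ, E) ∞ (extendByIdentity (chartAt E p) f : M → M) := by
  set e := chartAt E p
  intro m
  by_cases hm : m ∈ e.source
  · have h : ContMDiffOn 𝓘(ℝ, E) 𝓘(ℝ, E) ∞ (fun m => e.symm (f (e m))) e.source :=
      (contMDiffOn_chart_symm (n := ∞)).comp (hf.contMDiff.comp_contMDiffOn contMDiffOn_chart)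
        fun x hx => hmaps (e.map_source hx)
    have hnhds := e.open_source.mem_nhds hm
    refine (h.contMDiffAt hnhds).congr_of_eventuallyEq ?_
    filter_upwards [hnhds] with x hx using extendByIdentity_of_mem hx
  · have hcl : IsClosed (e.symm '' K) := (hK.image_of_continuousOn
      (e.continuousOn_symm.mono hKt)).isClosed
    have hmK : m ∉ e.symm '' K := by
      rintro ⟨z, hz, rfl⟩
      exact hm (e.map_target (hKt hz))
    refine contMDiffAt_id.congr_of_eventuallyEq ?_
    filter_upwards [hcl.isOpen_compl.mem_nhds hmK] with x hx
      using extendByIdentity_of_notMem hid hx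

/-- A compactly supported diffeomorphism of the range of a chart extends to `M`. -/
lemma exists_diffeomorph_extend [T2Space M] [IsManifold 𝓘(ℝ, E) ∞ M] (p : M)
    (f : E ≃ₘ^∞⟮𝓘(ℝ, E), 𝓘(ℝ, E)⟯ E) {K : Set E} (hK : IsCompact K)
    (hKt : K ⊆ (chartAt E p).target) (hid : ∀ z ∉ K, f z = z) :
    ∃ Φ : M ≃ₘ^∞⟮𝓘(ℝ, E), 𝓘(ℝ, E)⟯ M,
      (∀ m ∈ (chartAt E p).source, Φ m = (chartAt E p).symm (f (chartAt E p m))) ∧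
      ∀ m ∉ (chartAt E p).symm '' K, Φ m = m := by
  set e := chartAt E p
  have hid' : ∀ z ∉ K, f.symm z = z := fun z hz => by
    rw [← hid z hz, f.symm_apply_apply, hid z hz]
  -- An injective map that is the identity off `K` sends `K` into `K`.
  have hmaps : ∀ g h : E → E, Function.LeftInverse h g → (∀ z ∉ K, h z = z) →
      (∀ z ∉ K, g z = z) → MapsTo g e.target e.target := by
    intro g h hgh hh hg z hz
    by_cases hzK : z ∈ K
    · by_contra hgz
      have := hh (g z) fun h' => hgz (hKt h')
      rw [hgh] at this
      exact hgz (this ▸ hz)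
    · rwa [hg z hzK]
  have h₁ := hmaps f f.symm f.symm_apply_apply hid' hid
  have h₂ := hmaps f.symm f f.apply_symm_apply hid hid'
  refine ⟨⟨⟨extendByIdentity e f, extendByIdentity e f.symm,
    leftInverse_extendByIdentity f.symm_apply_apply h₁,
    leftInverse_extendByIdentity f.apply_symm_apply h₂⟩,
    contMDiff_extendByIdentity p f.contMDiff.contDiff hK hKt hid h₁,
    contMDiff_extendByIdentity p f.symm.contMDiff.contDiff hK hKt hid' h₂⟩,
    fun m hm => extendByIdentity_of_mem hm, fun m hm => extendByIdentity_of_notMem hid hm⟩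

/-! ### Transitivity of diffeomorphisms supported in an open set -/

/-- Orbits of the diffeomorphisms supported in an open set `U` are neighbourhoods of the points
of `U`. -/
lemma eventually_exists_diffeomorph_of_isOpen [FiniteDimensional ℝ E] [T2Space M]
    [IsManifold 𝓘(ℝ, E) ∞ M] {U : Set M} (hU : IsOpen U) {p : M} (hp : p ∈ U) :
    ∀ᶠ q in 𝓝 p, ∃ Φ : M ≃ₘ^∞⟮𝓘(ℝ, E), 𝓘(ℝ, E)⟯ M, Φ p = q ∧ ∀ m ∉ U, Φ m = m := by
  set e := chartAt E p
  have hps : p ∈ e.source := mem_chart_source E p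
  have hV : e.target ∩ e.symm ⁻¹' U ∈ 𝓝 (e p) :=
    (e.isOpen_inter_preimage_symm hU).mem_nhds
      ⟨e.map_source hps, by rwa [mem_preimage, e.left_inv hps]⟩
  obtain ⟨r, hr, hrV⟩ := nhds_basis_closedBall.mem_iff.1 hV
  filter_upwards [(e.continuousAt hps).eventually
    (eventually_exists_diffeomorph_closedBall (e p) hr), e.open_source.mem_nhds hps]
    with q ⟨f, hfp, hf⟩ hq
  obtain ⟨Φ, hΦ, hΦid⟩ := exists_diffeomorph_extend p f (isCompact_closedBall (e p) r)
    (fun z hz => (hrV hz).1) hf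
  refine ⟨Φ, by rw [hΦ p hps, hfp, e.left_inv hq], fun m hm => hΦid m ?_⟩
  rintro ⟨z, hz, rfl⟩
  exact hm (hrV hz).2

/-- Diffeomorphisms supported in a connected open set `U` act transitively on `U`. -/
lemma exists_diffeomorph_of_isPreconnected [FiniteDimensional ℝ E] [T2Space M]
    [IsManifold 𝓘(ℝ, E) ∞ M] {U : Set M} (hU : IsOpen U) (hc : IsPreconnected U) {p q : M}
    (hp : p ∈ U) (hq : q ∈ U) :
    ∃ Φ : M ≃ₘ^∞⟮𝓘(ℝ, E), 𝓘(ℝ, E)⟯ M, Φ p = q ∧ ∀ m ∉ U, Φ m = m := by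
  refine hc.induction₂ (fun a b => ∃ Φ : M ≃ₘ^∞⟮𝓘(ℝ, E), 𝓘(ℝ, E)⟯ M,
    Φ a = b ∧ ∀ m ∉ U, Φ m = m) ?_ ?_ ?_ hp hq
  · exact fun a ha => (eventually_exists_diffeomorph_of_isOpen hU ha).filter_mono
      nhdsWithin_le_nhds
  · rintro a b c - - - ⟨Φ, rfl, hΦ⟩ ⟨Ψ, rfl, hΨ⟩
    exact ⟨Φ.trans Ψ, rfl, fun m hm => by simp [hΦ m hm, hΨ m hm]⟩
  · rintro a b - - ⟨Φ, rfl, hΦ⟩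
    refine ⟨Φ.symm, Φ.symm_apply_apply a, fun m hm => ?_⟩
    rw [← hΦ m hm, Φ.symm_apply_apply, hΦ m hm]

/-! ### Complements of finite sets are connected -/

lemma isPreconnected_ball_diff_center (h : 1 < Module.rank ℝ E) (c : E) {r : ℝ} (hr : 0 < r) :
    IsPreconnected (ball c r \ {c}) := by
  let e := OpenPartialHomeomorph.univBall c r
  have himg : ball c r \ {c} = e '' {0}ᶜ := by
    have hinj : Function.Injective e := by
      rw [← injOn_univ, ← OpenPartialHomeomorph.univBall_source c r]
      exact e.injOn
    rw [image_compl_eq_range_sdiff_image hinj, image_singleton,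
      OpenPartialHomeomorph.univBall_apply_zero, ← image_univ,
      ← OpenPartialHomeomorph.univBall_source c r, e.image_source_eq_target,
      OpenPartialHomeomorph.univBall_target c hr]
  rw [himg]
  exact (isConnected_compl_singleton_of_one_lt_rank h 0).isPreconnected.image _
    (OpenPartialHomeomorph.continuous_univBall c r).continuousOn

/-- In dimension at least two, a point does not disconnect a connected open set. -/
lemma IsPreconnected.diff_singleton_of_one_lt_rank [T2Space M] (h : 1 < Module.rank ℝ E)
    {U : Set M} (hU : IsOpen U) (hc : IsPreconnected U) (p : M) : IsPreconnected (U \ {p}) := by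
  by_cases hp : p ∈ U
  swap
  · rwa [sdiff_singleton_eq_self hp]
  set e := chartAt E p
  have hps : p ∈ e.source := mem_chart_source E p
  have hV : e.target ∩ e.symm ⁻¹' U ∈ 𝓝 (e p) :=
    (e.isOpen_inter_preimage_symm hU).mem_nhds
      ⟨e.map_source hps, by rwa [mem_preimage, e.left_inv hps]⟩
  obtain ⟨r, hr, hrV⟩ := Metric.mem_nhds_iff.1 hV
  set W : Set M := e.symm '' ball (e p) r
  have hWo : IsOpen W := e.symm.isOpen_image_of_subset_source isOpen_ball fun z hz => (hrV hz).1
  have hpW : p ∈ W := ⟨e p, mem_ball_self hr, e.left_inv hps⟩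
  have hWU : W ⊆ U := by
    rintro _ ⟨z, hz, rfl⟩
    exact (hrV hz).2
  have hWc : IsPreconnected (W \ {p}) := by
    have : W \ {p} = e.symm '' (ball (e p) r \ {e p}) := by
      ext m
      constructor
      · rintro ⟨⟨z, hz, rfl⟩, hm⟩
        refine ⟨z, ⟨hz, fun hze => hm ?_⟩, rfl⟩
        rw [mem_singleton_iff.1 hze]
        exact e.left_inv hps
      · rintro ⟨z, ⟨hz, hne⟩, rfl⟩
        refine ⟨⟨z, hz, rfl⟩, fun hm => hne ?_⟩
        rw [mem_singleton_iff] at hm ⊢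
        rw [← hm, e.right_inv (hrV hz).1]
    rw [this]
    exact (isPreconnected_ball_diff_center h _ hr).image _
      (e.continuousOn_symm.mono fun z hz => (hrV hz.1).1)
  -- If `A`, `B` separated `U \ {p}` and `A` contained the punctured neighbourhood `W \ {p}`,
  -- then `A ∪ W` and `B \ {p}` would separate `U`.
  have key : ∀ A B : Set M, IsOpen A → IsOpen B → U \ {p} ⊆ A ∪ B → (U \ {p} ∩ B).Nonempty →
      W \ {p} ⊆ A → (U \ {p} ∩ (A ∩ B)).Nonempty := by
    rintro A B hA hB hAB ⟨b, hbU, hbB⟩ hWA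
    obtain ⟨m, hmU, hm, hmB, hmp⟩ := hc (A ∪ W) (B \ {p}) (hA.union hWo)
      (hB.sdiff isClosed_singleton) (fun m hm => by
        by_cases hmp : m = p
        · exact Or.inl (Or.inr (hmp ▸ hpW))
        · exact (hAB ⟨hm, hmp⟩).imp Or.inl fun hB => ⟨hB, hmp⟩)
      ⟨p, hp, Or.inr hpW⟩ ⟨b, hbU.1, hbB, hbU.2⟩
    exact ⟨m, ⟨hmU, hmp⟩, hm.elim id fun hW => hWA ⟨hW, hmp⟩, hmB⟩
  intro A B hA hB hAB hnA hnB
  by_contra hcon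
  have hdisj : W \ {p} ∩ (A ∩ B) = ∅ := by
    rw [← not_nonempty_iff_eq_empty]
    exact fun hne => hcon (hne.mono (inter_subset_inter_left _ (sdiff_subset_sdiff_left hWU)))
  rcases isPreconnected_iff_subset_of_disjoint.1 hWc A B hA hB
    ((sdiff_subset_sdiff_left hWU).trans hAB) hdisj with hW | hW
  · exact hcon (key A B hA hB hAB hnB hW)
  · rw [inter_comm A B] at hcon
    exact hcon (key B A hB hA (union_comm A B ▸ hAB) hnA hW)

lemma isPreconnected_compl_finset [T2Space M] [PreconnectedSpace M] (h : 1 < Module.rank ℝ E)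
    (F : Finset M) : IsPreconnected ((F : Set M)ᶜ) := by
  classical
  induction F using Finset.induction_on with
  | empty => simpa using isPreconnected_univ
  | insert p F _ ih =>
    have : ((insert p F : Finset M) : Set M)ᶜ = (F : Set M)ᶜ \ {p} := by
      ext m
      simp [and_comm]
    rw [this]
    exact ih.diff_singleton_of_one_lt_rank h F.finite_toSet.isClosed.isOpen_compl p

end Manifold

/-! ### Moving finitely many points -/

theorem theorem4p7 (d : ℕ) (hd : 2 ≤ d)
    (M : Type*) [TopologicalSpace M] [T2Space M] [ConnectedSpace M]
    [ChartedSpace (EuclideanSpace ℝ (Fin d)) M] [IsManifold (𝓡 d) ∞ M]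
    (n : ℕ) (x y : Fin n → M) (hxy : Concordant fun i => (x i, y i)) :
    ∃ Φ : M ≃ₘ^∞⟮𝓡 d, 𝓡 d⟯ M, ∀ i, Φ (x i) = y i := by
  classical
  have hrank : 1 < Module.rank ℝ (EuclideanSpace ℝ (Fin d)) :=
    Module.one_lt_rank_of_one_lt_finrank (by rw [finrank_euclideanSpace_fin]; omega)
  suffices H : ∀ s : Finset (Fin n), ∃ Φ : M ≃ₘ^∞⟮𝓡 d, 𝓡 d⟯ M, ∀ i ∈ s, Φ (x i) = y i by
    obtain ⟨Φ, hΦ⟩ := H Finset.univ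
    exact ⟨Φ, fun i => hΦ i (Finset.mem_univ i)⟩
  intro s
  induction s using Finset.induction_on with
  | empty => exact ⟨Diffeomorph.refl _ _ _, by simp⟩
  | insert k s hk ih =>
    obtain ⟨Φ, hΦ⟩ := ih
    -- Move `Φ (x k)` to `y k` in the complement of the targets already reached.
    have hne : ∀ i ∈ s, i ≠ k := fun i hi hik => hk (hik ▸ hi)
    have hxk : Φ (x k) ∈ ((s.image y : Finset M) : Set M)ᶜ := by
      simp only [Finset.coe_image, mem_compl_iff, mem_image, not_exists, not_and]
      intro i hi hik
      rw [← hΦ i hi] at hik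
      exact (hxy i k (hne i hi)).1 (Φ.injective hik)
    have hyk : y k ∈ ((s.image y : Finset M) : Set M)ᶜ := by
      simp only [Finset.coe_image, mem_compl_iff, mem_image, not_exists, not_and]
      exact fun i hi => (hxy i k (hne i hi)).2
    obtain ⟨Ψ, hΨk, hΨ⟩ := exists_diffeomorph_of_isPreconnected (E := EuclideanSpace ℝ (Fin d))
      (s.image y).finite_toSet.isClosed.isOpen_compl
      (isPreconnected_compl_finset hrank (s.image y)) hxk hyk
    refine ⟨Φ.trans Ψ, fun i hi => ?_⟩
    rcases Finset.mem_insert.1 hi with rfl | hi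
    · exact hΨk
    · rw [Diffeomorph.coe_trans, Function.comp_apply, hΦ i hi]
      exact hΨ _ (not_not.2 (Finset.mem_coe.2 (Finset.mem_image_of_mem y hi)))
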